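/- **Proposition 5.2.** Let $1<\alpha\le 2$, $d\ge 1$, $T>0$, and let $\dot W=(\dot W^1,\dots,\dot W^d)$ be a vector of $d$ independent space-time white noises on $[0,T]\times\mathbb R$ defined on a probability space $(\Omega,\mathscr F,\mathrm P)$. Let $v=(v_1,\dots,v_d)=\{v(t,x),\ t\in[0,T],\ x\in\mathbb R\}$ be the mild solution of the system of stochastic fractional heat equations with vanishing initial condition $$\frac{\partial u_i}{\partial t}(t,x)={}_xD^{\alpha}u_i(t,x)+\sum_{j=1}^d\sigma_{ij}(u(t,x))\,\dot W^j(t,x)+b_i(u(t,x)),\qquad 1\le i\le d,$$ in the Gaussian case $\sigma\equiv\mathrm{Id}$, $b\equiv 0$. Here $D^\alpha$ is the Fourier multiplier with symbol $-|\lambda|^\alpha$, with Green kernel $G_\alpha(t,x)=\frac1{2\pi}\int_{\mathbb R}e^{-i\lambda x-t|\lambda|^\alpha}\,d\lambda$ for $t>0$, and a mild solution is a jointly measurable process $u$, adapted to the ($\mathrm P$-augmented) filtration of the noise, such that for every $(t,x)$ and $i$, almost surely, $$u_i(t,x)=\int_0^t\!\int_{\mathbb R}G_\alpha(t-r,x-v)\sum_{j=1}^d\sigma_{ij}(u(r,v))\,W^j(dr,dv)+\int_0^t\!\int_{\mathbb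 R}G_\alpha(t-r,x-v)\,b_i(u(r,v))\,dr\,dv,$$ the stochastic integral being understood in the sense of Walsh. Then for any $0<t_0<T$, any real $p>1$ and any compact set $K\subset\mathbb R$ there is a constant $c_1=c_1(\alpha,p,t_0,K)>0$, depending only on $\alpha,p,t_0,K$, such that for all $t_0\le s\le t\le T$ and all $x,y\in K$, $$\mathrm E\big[|v_1(t,x)-v_1(s,y)|^p\big]\ \ge\ c_1\Big(|t-s|^{\frac{\alpha-1}{\alpha}}+|x-y|^{\alpha-1}\Big)^{p/2}.$$ -/

import Mathlib

open MeasureTheory ProbabilityTheory Filter Topology Set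

noncomputable section

namespace FracHeat

/-- The Green kernel of the fractional heat operator `∂/∂t - D^α`,
`G_α(t, x) = (2π)⁻¹ ∫_ℝ exp(-iλx - t|λ|^α) dλ` for `t > 0`. The integral is a real number since the
integrand at `-λ` is the conjugate of the integrand at `λ`. For `α = 2` this is the heat kernel
`(4πt)^(-1/2) exp(-x²/(4t))`. -/
def greenKernel (α t x : ℝ) : ℝ :=
  (1 / (2 * Real.pi)) *
    (∫ l : ℝ, Complex.exp (-Complex.I * (l : ℂ) * (x : ℂ) - ((t * |l| ^ α : ℝ) : ℂ))).re

/-- For `α = 2` the Green kernel is the Gaussian heat kernel. -/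
theorem greenKernel_two {t : ℝ} (ht : 0 < t) (x : ℝ) :
    greenKernel 2 t x = (4 * Real.pi * t) ^ (-(1 / 2) : ℝ) * Real.exp (-x ^ 2 / (4 * t)) := by
  have hpi := Real.pi_pos
  have h := fourierIntegral_gaussian (b := (t : ℂ)) (by simpa using ht) (-(x : ℂ))
  have e : (∫ l : ℝ, Complex.exp (-Complex.I * (l : ℂ) * (x : ℂ) -
      ((t * |l| ^ (2 : ℝ) : ℝ) : ℂ))) =
      (((Real.pi / t) ^ (1 / 2 : ℝ) * Real.exp (-x ^ 2 / (4 * t)) : ℝ) : ℂ) := by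
    have e1 : (((Real.pi / t) ^ (1 / 2 : ℝ) * Real.exp (-x ^ 2 / (4 * t)) : ℝ) : ℂ) =
        ((Real.pi : ℂ) / t) ^ (1 / 2 : ℂ) * Complex.exp (-(-(x : ℂ)) ^ 2 / (4 * t)) := by
      rw [Complex.ofReal_mul, Complex.ofReal_cpow (by positivity)]
      push_cast
      congr 2
      ring
    rw [e1, ← h]
    congr 1
    ext l
    rw [← Complex.exp_add]
    congr 1
    have : |l| ^ (2 : ℝ) = l ^ 2 := by rw [Real.rpow_two, sq_abs]
    rw [this]
    push_cast
    ring
  rw [greenKernel, e, Complex.ofReal_re, ← mul_assoc]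
  congr 1
  rw [Real.rpow_neg (by positivity), ← Real.sqrt_eq_rpow, ← Real.sqrt_eq_rpow]
  have h4 : (Real.sqrt (4 * Real.pi * t)) = 2 * Real.sqrt Real.pi * Real.sqrt t := by
    rw [Real.sqrt_mul (by positivity), Real.sqrt_mul (by norm_num)]
    norm_num
  rw [h4, Real.sqrt_div hpi.le]
  have hp : Real.sqrt Real.pi * Real.sqrt Real.pi = Real.pi := Real.mul_self_sqrt hpi.le
  have h1 : Real.sqrt Real.pi ≠ 0 := by positivity
  have h2 : Real.sqrt t ≠ 0 := by positivity
  field_simp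
  nlinarith [hp]

/-- The time-space strip `[0, T] × ℝ`. -/
def strip (T : ℝ) : Set (ℝ × ℝ) := Icc 0 T ×ˢ univ

/-- The index sets of a white noise on `[0, T] × ℝ`: Borel subsets of finite Lebesgue measure. -/
abbrev NoiseSet (T : ℝ) : Type :=
  {A : Set (ℝ × ℝ) // MeasurableSet A ∧ A ⊆ strip T ∧ volume A < ⊤}

variable {Ω : Type*} [MeasurableSpace Ω] {d : ℕ}

/-- `W = (W¹, …, W^d)` is a vector of `d` independent space-time white noises on `[0, T] × ℝ`:
the variables `W^j(A)` form a centered Gaussian family with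
`E[W^j(A) W^k(B)] = δ_{jk} |A ∩ B|`. Values of `W` on other sets are irrelevant. -/
structure IsWhiteNoise (P : Measure Ω) (T : ℝ) (W : Fin d → Set (ℝ × ℝ) → Ω → ℝ) : Prop where
  measurable : ∀ (j : Fin d) (A : NoiseSet T), Measurable (W j A)
  gaussian : IsGaussianProcess (fun (q : Fin d × NoiseSet T) (ω : Ω) => W q.1 q.2 ω) P
  mean_zero : ∀ (j : Fin d) (A : NoiseSet T), ∫ ω, W j A ω ∂P = 0
  covariance : ∀ (j k : Fin d) (A B : NoiseSet T),
    ∫ ω, W j A ω * W k B ω ∂P =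
      if j = k then (volume ((A : Set (ℝ × ℝ)) ∩ B)).toReal else 0

/-- The filtration `𝓕_t` of the noise: the σ-field generated by the noise on `[0, t] × ℝ` (all
components), augmented by the `P`-null sets. -/
@[reducible] def noiseSigma (P : Measure Ω) (T : ℝ) (W : Fin d → Set (ℝ × ℝ) → Ω → ℝ) (t : ℝ) :
    MeasurableSpace Ω :=
  (⨆ (j : Fin d) (A : NoiseSet T) (_ : (A : Set (ℝ × ℝ)) ⊆ strip t),
      MeasurableSpace.comap (W j A) inferInstance) ⊔
    MeasurableSpace.generateFrom {N : Set Ω | MeasurableSet N ∧ P N = 0}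

/-- A simple integrand in the sense of Walsh: a finite sum
`∑ₖ Xₖ(ω) 1_{(aₖ, bₖ]}(r) 1_{Aₖ}(v)`, where `0 ≤ aₖ ≤ bₖ ≤ T`, `Xₖ` is bounded and
`𝓕_{aₖ}`-measurable, and `Aₖ` is a Borel set of finite length. -/
structure SimpleIntegrand (P : Measure Ω) (T : ℝ) (W : Fin d → Set (ℝ × ℝ) → Ω → ℝ) where
  n : ℕ
  a : Fin n → ℝ
  b : Fin n → ℝ
  A : Fin n → Set ℝ
  X : Fin n → Ω → ℝ
  a_nonneg : ∀ k, 0 ≤ a k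
  a_le_b : ∀ k, a k ≤ b k
  b_le : ∀ k, b k ≤ T
  measurableSet_A : ∀ k, MeasurableSet (A k)
  volume_A : ∀ k, volume (A k) < ⊤
  measurable_X : ∀ k, Measurable[noiseSigma P T W (a k)] (X k)
  bounded_X : ∀ k, ∃ C : ℝ, ∀ ω, |X k ω| ≤ C

variable {P : Measure Ω} {T : ℝ} {W : Fin d → Set (ℝ × ℝ) → Ω → ℝ}

/-- The value of a simple integrand at `((r, v), ω)`. -/
def SimpleIntegrand.eval (S : SimpleIntegrand P T W) (q : (ℝ × ℝ) × Ω) : ℝ :=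
  ∑ k, S.X k q.2 * (Ioc (S.a k) (S.b k) ×ˢ S.A k).indicator (fun _ => (1 : ℝ)) q.1

/-- The stochastic integral of a simple integrand against `W^j`:
`∑ₖ Xₖ W^j((aₖ, bₖ] × Aₖ)`. -/
def SimpleIntegrand.integral (S : SimpleIntegrand P T W) (j : Fin d) (ω : Ω) : ℝ :=
  ∑ k, S.X k ω * W j (Ioc (S.a k) (S.b k) ×ˢ S.A k) ω

/-- `I` is (a version of) the Walsh stochastic integral
`∫_{[0,T]} ∫_ℝ Φ(r, v, ω) W^j(dr, dv)`: `Φ` is the limit in `L²([0, T] × ℝ × Ω)` of simple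
integrands whose integrals converge to `I` in `L²(Ω)`. -/
def IsWalshIntegral (P : Measure Ω) (T : ℝ) (W : Fin d → Set (ℝ × ℝ) → Ω → ℝ) (j : Fin d)
    (Φ : (ℝ × ℝ) × Ω → ℝ) (I : Ω → ℝ) : Prop :=
  MemLp Φ 2 ((volume.restrict (strip T)).prod P) ∧ MemLp I 2 P ∧
    ∃ S : ℕ → SimpleIntegrand P T W,
      Tendsto (fun n => eLpNorm ((S n).eval - Φ) 2 ((volume.restrict (strip T)).prod P))
        atTop (𝓝 0) ∧
      Tendsto (fun n => eLpNorm ((S n).integral j - I) 2 P) atTop (𝓝 0)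

/-- `u` is a mild solution on `[0, T] × ℝ`, with vanishing initial condition, of the system
`∂u_i/∂t = D^α u_i + ∑_j σ_{ij}(u) Ẇ^j + b_i(u)`, `1 ≤ i ≤ d`: a jointly measurable process, adapted
to the filtration of the noise, such that for all `(t, x)` and `i`, almost surely,
`u_i(t, x) = ∑_j ∫_0^t ∫_ℝ G_α(t - r, x - v) σ_{ij}(u(r, v)) W^j(dr, dv)`
`+ ∫_0^t ∫_ℝ G_α(t - r, x - v) b_i(u(r, v)) dr dv`. -/
structure IsMildSolution (α : ℝ) (P : Measure Ω) (T : ℝ) (W : Fin d → Set (ℝ × ℝ) → Ω → ℝ)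
    (σ : (Fin d → ℝ) → Matrix (Fin d) (Fin d) ℝ) (b : (Fin d → ℝ) → Fin d → ℝ)
    (u : ℝ → ℝ → Ω → Fin d → ℝ) : Prop where
  measurable : Measurable (fun q : Icc (0 : ℝ) T × ℝ × Ω => u q.1 q.2.1 q.2.2)
  adapted : ∀ t ∈ Icc 0 T, ∀ x : ℝ, Measurable[noiseSigma P T W t] (u t x)
  mild : ∀ t ∈ Icc 0 T, ∀ (x : ℝ) (i : Fin d), ∃ I : Fin d → Ω → ℝ,
    (∀ j : Fin d, IsWalshIntegral P T W j
      (fun q => if q.1.1 < t then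
          greenKernel α (t - q.1.1) (x - q.1.2) * σ (u q.1.1 q.1.2 q.2) i j else 0) (I j)) ∧
    (∀ᵐ ω ∂P, IntegrableOn
      (fun z : ℝ × ℝ => greenKernel α (t - z.1) (x - z.2) * b (u z.1 z.2 ω) i) (strip t)) ∧
    (∀ᵐ ω ∂P, u t x ω i = ∑ j, I j ω +
      ∫ z in strip t, greenKernel α (t - z.1) (x - z.2) * b (u z.1 z.2 ω) i)

end FracHeat

end

noncomputable section

namespace FracHeat

open scoped FourierTransform ENNReal NNReal

/-! With additive noise, `v₁(t,x) - v₁(s,y)` is the Walsh integral of the deterministic kernel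
`heatIntegrand α t x - heatIntegrand α s y`. It is therefore centered Gaussian, and its variance is
the squared `L²` norm of that kernel (`IsMildSolution.map_sub_eq_gaussianReal`). A centered Gaussian
moment of order `p` is `E|N|^p` times the variance to the power `p/2`, so everything reduces to a
lower bound on the variance (`exists_le_lintegral_heatIntegrand`).

That bound uses Plancherel in space. For `r` in `(s,t)` only one kernel is present; its `L²(dv)`
norm squared is at least of order `(t-s)^(-1/α)`, and integrating in `r` gives the time term. If `t
- s ≤ |x-y|^α`, then for `r` in a window of length `δ|x-y|^α` before `s`, and for frequencies of
order `1/|x-y|`, neither symbol has decayed while their phases differ by an angle in `[1,2]`; this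
gives `|x-y|^(α-1)`. The bounds `t₀ ≤ s` and `x, y ∈ K` make the window fit in `[0,s]`. If instead
`t - s ≥ |x-y|^α`, the time term dominates the space term.

On the probabilistic side, the simple integrands approximating a deterministic kernel may be random.
Replacing their coefficients by their means brings them no further from the kernel and makes their
integrals Gaussian; the Itô isometry then carries Gaussianity to the limit. -/

/-! ### Plancherel's theorem on `L¹ ∩ L²`. -/

theorem continuous_fourier_of_integrable {f : ℝ → ℂ} (hf : Integrable f) : Continuous (𝓕 f) := by
  simpa using! VectorFourier.fourierIntegral_continuous (L := innerₗ ℝ)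
    Real.continuous_fourierChar continuous_inner hf

/-- The Fourier integral of a function in `L¹ ∩ L²` represents its `L²` Fourier transform. -/
theorem fourier_toLp_ae_eq {f : ℝ → ℂ} (hf : Integrable f) (hf2 : MemLp f 2) :
    (𝓕 (hf2.toLp f) : Lp ℂ 2 (volume : Measure ℝ)) =ᵐ[volume] 𝓕 f := by
  -- Both functions are tested against smooth compactly supported `g`, seen as Schwartz functions.
  -- On each side the Fourier transform moves onto `g`: by definition for tempered distributions, by
  -- Fubini for the integral.
  refine ae_eq_of_integral_contDiff_smul_eq ((Lp.memLp _).locallyIntegrable (by norm_num))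
    (continuous_fourier_of_integrable hf).locallyIntegrable fun g hg hgc => ?_
  have hg₁ : HasCompactSupport (Complex.ofRealCLM ∘ g) := hgc.comp_left rfl
  have hg₂ : ContDiff ℝ (⊤ : ℕ∞) (Complex.ofRealCLM ∘ g) := by fun_prop
  set ψ := hg₁.toSchwartzMap hg₂ with hψ
  have hψx : ∀ x, ψ x = (g x : ℂ) := fun _ => rfl
  have h1 := Lp.toTemperedDistribution_apply (μ := volume)
    (𝓕 (hf2.toLp f) : Lp ℂ 2 (volume : Measure ℝ)) ψ
  have h2 := Lp.toTemperedDistribution_apply (μ := volume) (hf2.toLp f) (𝓕 ψ)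
  rw [← Lp.fourier_toTemperedDistribution_eq, TemperedDistribution.fourier_apply, h2] at h1
  have h3 : ∫ ξ, 𝓕 (ψ : ℝ → ℂ) ξ • f ξ = ∫ x, ψ x • 𝓕 f x := by
    simpa using! VectorFourier.integral_fourierIntegral_smul_eq_flip (L := innerₗ ℝ)
      Real.continuous_fourierChar continuous_inner (ψ.integrable (μ := volume)) hf
  have h4 : ∫ ξ, (𝓕 ψ : SchwartzMap ℝ ℂ) ξ • (hf2.toLp f) ξ = ∫ ξ, 𝓕 (ψ : ℝ → ℂ) ξ • f ξ := by
    refine integral_congr_ae ?_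
    filter_upwards [hf2.coeFn_toLp] with x hx
    rw [hx, SchwartzMap.fourier_coe]
  rw [h4, h3] at h1
  simp only [hψx, Complex.coe_smul] at h1
  simpa only [← Complex.coe_smul] using h1.symm

/-- Plancherel's theorem for functions in `L¹ ∩ L²`. -/
theorem lintegral_enorm_fourier_sq {f : ℝ → ℂ} (hf : Integrable f) (hf2 : MemLp f 2) :
    ∫⁻ x, ‖𝓕 f x‖ₑ ^ 2 = ∫⁻ x, ‖f x‖ₑ ^ 2 := by
  have key : eLpNorm (𝓕 f) 2 volume = eLpNorm f 2 volume := by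
    rw [← eLpNorm_congr_ae (fourier_toLp_ae_eq hf hf2), ← eLpNorm_congr_ae hf2.coeFn_toLp,
      ← Lp.enorm_def, ← Lp.enorm_def, ← ofReal_norm, ← ofReal_norm, Lp.norm_fourier_eq]
  rw [eLpNorm_eq_lintegral_rpow_enorm_toReal two_ne_zero ENNReal.ofNat_ne_top,
    eLpNorm_eq_lintegral_rpow_enorm_toReal two_ne_zero ENNReal.ofNat_ne_top] at key
  simpa using ENNReal.rpow_left_injective (by norm_num) key

/-! ### The Green kernel in Fourier variables. -/

theorem continuous_exp_neg_mul_abs_rpow {α : ℝ} (hα : 0 < α) (τ : ℝ) :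
    Continuous fun l : ℝ => Real.exp (-(τ * |l| ^ α)) := by
  have : Continuous fun l : ℝ => |l| ^ α :=
    continuous_abs.rpow_const fun _ => Or.inr hα.le
  fun_prop

theorem integrable_exp_neg_mul_abs_rpow {α τ : ℝ} (hα : 0 < α) (hτ : 0 < τ) :
    Integrable fun l : ℝ => Real.exp (-(τ * |l| ^ α)) := by
  have h : IntegrableOn (fun l : ℝ => Real.exp (-(τ * |l| ^ α))) (Ioi 0) := by
    refine (integrableOn_rpow_mul_exp_neg_mul_rpow (s := 0) (by norm_num) hα hτ).congr_fun
      (fun x hx => ?_) measurableSet_Ioi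
    simp [abs_of_pos (mem_Ioi.1 hx)]
  have h' : IntegrableOn (fun l : ℝ => Real.exp (-(τ * |l| ^ α))) (Iio 0) := by
    simpa using h.comp_neg
  rw [← integrableOn_univ, ← Iic_union_Ioi (a := (0 : ℝ)), integrableOn_union,
    integrableOn_Iic_iff_integrableOn_Iio]
  exact ⟨h', h⟩

/-- The Fourier transform of the Green kernel, with a phase for the translation by `x`. -/
def greenSymbol (α τ x ξ : ℝ) : ℂ :=
  Complex.exp ((2 * Real.pi * ξ * x : ℝ) * Complex.I) *
    (Real.exp (-(τ * |2 * Real.pi * ξ| ^ α)) : ℝ)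

theorem norm_greenSymbol (α τ x ξ : ℝ) :
    ‖greenSymbol α τ x ξ‖ = Real.exp (-(τ * |2 * Real.pi * ξ| ^ α)) := by
  rw [greenSymbol, norm_mul, Complex.norm_exp_ofReal_mul_I, one_mul, Complex.norm_real,
    Real.norm_of_nonneg (Real.exp_pos _).le]

theorem continuous_greenSymbol {α : ℝ} (hα : 0 < α) (τ x : ℝ) :
    Continuous (greenSymbol α τ x) := by
  have := (continuous_exp_neg_mul_abs_rpow hα τ).comp (continuous_const_mul (2 * Real.pi))
  unfold greenSymbol
  exact (by fun_prop : Continuous fun ξ : ℝ =>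
    Complex.exp ((2 * Real.pi * ξ * x : ℝ) * Complex.I)).mul (Complex.continuous_ofReal.comp this)

theorem integrable_greenSymbol {α τ : ℝ} (hα : 0 < α) (hτ : 0 < τ) (x : ℝ) :
    Integrable (greenSymbol α τ x) := by
  have h := (integrable_exp_neg_mul_abs_rpow hα hτ).comp_mul_left'
    (R := 2 * Real.pi) (by positivity)
  refine h.mono (continuous_greenSymbol hα τ x).aestronglyMeasurable (ae_of_all _ fun ξ => ?_)
  rw [norm_greenSymbol, Real.norm_of_nonneg (Real.exp_pos _).le]

theorem memLp_greenSymbol {α τ : ℝ} (hα : 0 < α) (hτ : 0 < τ) (x : ℝ) :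
    MemLp (greenSymbol α τ x) 2 := by
  rw [memLp_two_iff_integrable_sq_norm (continuous_greenSymbol hα τ x).aestronglyMeasurable]
  have h := (integrable_exp_neg_mul_abs_rpow hα (mul_pos two_pos hτ)).comp_mul_left'
    (R := 2 * Real.pi) (by positivity)
  refine h.congr (ae_of_all _ fun ξ => ?_)
  simp only [norm_greenSymbol]
  rw [← Real.exp_nat_mul]
  congr 1
  push_cast
  ring

theorem greenKernel_eq_fourier (α τ x v : ℝ) :
    ((greenKernel α τ (x - v) : ℝ) : ℂ) = 𝓕 (greenSymbol α τ x) v := by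
  set g : ℝ → ℂ := fun l => Complex.exp (-Complex.I * (l : ℂ) * ((x - v : ℝ) : ℂ) -
    ((τ * |l| ^ α : ℝ) : ℂ)) with hg
  -- The substitution `l ↦ -l` shows that the integral equals its conjugate.
  have hreal : (((∫ l, g l).re : ℝ) : ℂ) = ∫ l, g l := by
    rw [← Complex.conj_eq_iff_re, ← integral_conj, ← integral_neg_eq_self g]
    congr 1
    ext l
    simp only [hg, ← Complex.exp_conj, map_sub, map_mul, map_neg, Complex.conj_I,
      Complex.conj_ofReal, abs_neg, Complex.ofReal_neg]
    congr 1
    ring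
  rw [greenKernel, Complex.ofReal_mul, hreal, Real.fourier_real_eq_integral_exp_smul]
  -- The substitution is `l = -2πξ`; its Jacobian is the prefactor `1/(2π)` of the kernel.
  have h := Measure.integral_comp_mul_left g (-(2 * Real.pi))
  have h2 : ∀ ξ : ℝ, Complex.exp (↑(-2 * Real.pi * ξ * v) * Complex.I) • greenSymbol α τ x ξ =
      g (-(2 * Real.pi) * ξ) := by
    intro ξ
    simp only [hg, greenSymbol, smul_eq_mul, Complex.ofReal_exp]
    rw [← mul_assoc, ← Complex.exp_add, ← Complex.exp_add]
    congr 1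
    rw [neg_mul (2 * Real.pi) ξ, abs_neg]
    push_cast
    ring
  simp_rw [h2]
  rw [h, Complex.real_smul]
  congr 1
  rw [abs_inv, abs_neg, abs_of_pos (by positivity), one_div]

theorem measurable_greenKernel (α : ℝ) :
    Measurable fun q : ℝ × ℝ => greenKernel α q.1 q.2 := by
  unfold greenKernel
  refine Measurable.const_mul (Complex.measurable_re.comp ?_) _
  refine (StronglyMeasurable.integral_prod_right (f := fun (q : ℝ × ℝ) (l : ℝ) =>
    Complex.exp (-Complex.I * (l : ℂ) * (q.2 : ℂ) - ((q.1 * |l| ^ α : ℝ) : ℂ))) ?_).measurable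
  refine Measurable.stronglyMeasurable ?_
  simp only [Function.uncurry_def]
  fun_prop

/-- Plancherel's theorem for a single Green kernel. -/
theorem lintegral_greenKernel_sq {α τ : ℝ} (hα : 0 < α) (hτ : 0 < τ) (x : ℝ) :
    ∫⁻ v, ‖greenKernel α τ (x - v)‖ₑ ^ 2 = ∫⁻ ξ, ‖greenSymbol α τ x ξ‖ₑ ^ 2 := by
  rw [← lintegral_enorm_fourier_sq (integrable_greenSymbol hα hτ x) (memLp_greenSymbol hα hτ x)]
  simp_rw [← greenKernel_eq_fourier, ← ofReal_norm, Complex.norm_real]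

/-- Plancherel's theorem for a difference of Green kernels. -/
theorem lintegral_greenKernel_sub_sq {α τ τ' : ℝ} (hα : 0 < α) (hτ : 0 < τ) (hτ' : 0 < τ')
    (x y : ℝ) :
    ∫⁻ v, ‖greenKernel α τ (x - v) - greenKernel α τ' (y - v)‖ₑ ^ 2 =
      ∫⁻ ξ, ‖greenSymbol α τ x ξ - greenSymbol α τ' y ξ‖ₑ ^ 2 := by
  have hi := integrable_greenSymbol hα hτ x
  have hi' := integrable_greenSymbol hα hτ' y
  have key := lintegral_enorm_fourier_sq (hi.sub hi')
    ((memLp_greenSymbol hα hτ x).sub (memLp_greenSymbol hα hτ' y))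
  simp only [Pi.sub_apply] at key
  rw [← key]
  have : ∀ v, 𝓕 (greenSymbol α τ x - greenSymbol α τ' y) v =
      ((greenKernel α τ (x - v) - greenKernel α τ' (y - v) : ℝ) : ℂ) := by
    intro v
    rw [Complex.ofReal_sub, greenKernel_eq_fourier, greenKernel_eq_fourier]
    simp only [Real.fourier_eq, Pi.sub_apply, smul_sub]
    exact integral_sub ((Real.fourierIntegral_convergent_iff v).2 hi)
      ((Real.fourierIntegral_convergent_iff v).2 hi')
  simp_rw [this, ← ofReal_norm, Complex.norm_real]

/-! ### Lower bounds for `L²` norms of kernels at fixed times. -/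

theorem const_mul_measure_le_lintegral {β : Type*} [MeasurableSpace β] {μ : Measure β} {A : Set β}
    {f : β → ℝ≥0∞} {c : ℝ≥0∞} (hA : MeasurableSet A) (h : ∀ x ∈ A, c ≤ f x) :
    c * μ A ≤ ∫⁻ x, f x ∂μ :=
  calc c * μ A = ∫⁻ _ in A, c ∂μ := by simp
    _ ≤ ∫⁻ x in A, f x ∂μ := setLIntegral_mono' hA h
    _ ≤ ∫⁻ x, f x ∂μ := setLIntegral_le_lintegral _ _

theorem ofReal_le_enorm_sq {E : Type*} [NormedAddCommGroup E] {c : ℝ} {z : E} (h : c ≤ ‖z‖ ^ 2) :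
    ENNReal.ofReal c ≤ ‖z‖ₑ ^ 2 := by
  rw [← ofReal_norm, ← ENNReal.ofReal_pow (norm_nonneg z)]
  exact ENNReal.ofReal_le_ofReal h

/-- On the band `|2πξ| ≤ h^(-1/α)` one has `τ|2πξ|^α ≤ 1`, so the squared symbol is at least `e⁻²`.
The band has length `h^(-1/α)/π`. -/
theorem le_lintegral_greenKernel_sq {α τ h : ℝ} (hα : 0 < α) (hτ : 0 < τ) (hτh : τ ≤ h) (x : ℝ) :
    ENNReal.ofReal (Real.exp (-2) / Real.pi * h ^ (-1 / α)) ≤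
      ∫⁻ v, ‖greenKernel α τ (x - v)‖ₑ ^ 2 := by
  have hpi := Real.pi_pos
  have hh : 0 < h := hτ.trans_le hτh
  rw [lintegral_greenKernel_sq hα hτ]
  set R := h ^ (-1 / α) / (2 * Real.pi) with hR
  have hb := const_mul_measure_le_lintegral (μ := volume) (A := Icc (-R) R)
    (f := fun ξ => ‖greenSymbol α τ x ξ‖ₑ ^ 2) (c := ENNReal.ofReal (Real.exp (-2)))
    measurableSet_Icc fun ξ hξ => ?_
  · refine le_trans (le_of_eq ?_) hb
    rw [Real.volume_Icc, ← ENNReal.ofReal_mul (Real.exp_pos _).le, hR]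
    congr 1
    field_simp
    ring
  · refine ofReal_le_enorm_sq ?_
    rw [norm_greenSymbol, ← Real.exp_nat_mul, Real.exp_le_exp]
    have h1 : |2 * Real.pi * ξ| ≤ h ^ (-1 / α) := by
      rw [abs_mul, abs_of_pos (by positivity : 0 < 2 * Real.pi)]
      have : |ξ| ≤ R := abs_le.2 hξ
      rw [hR, le_div_iff₀ (by positivity)] at this
      linarith
    have h2 : |2 * Real.pi * ξ| ^ α ≤ h⁻¹ := by
      refine (Real.rpow_le_rpow (abs_nonneg _) h1 hα.le).trans_eq ?_
      rw [← Real.rpow_mul hh.le, div_mul_cancel₀ _ hα.ne', Real.rpow_neg_one]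
    have h3 : τ * |2 * Real.pi * ξ| ^ α ≤ 1 :=
      (mul_le_mul hτh h2 (by positivity) hh.le).trans_eq (mul_inv_cancel₀ hh.ne')
    push_cast
    linarith

/-- The right side exceeds the left by exactly `(a - b)²`. -/
theorem le_norm_exp_mul_sub_sq (a b X Y : ℝ) :
    2 * a * b * (1 - Real.cos (X - Y)) ≤
      ‖Complex.exp ((X : ℝ) * Complex.I) * (a : ℝ) - Complex.exp ((Y : ℝ) * Complex.I) * (b : ℝ)‖
        ^ 2 := by
  rw [← Complex.normSq_eq_norm_sq, Complex.normSq_apply, Complex.exp_mul_I, Complex.exp_mul_I,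
    ← Complex.ofReal_cos, ← Complex.ofReal_cos, ← Complex.ofReal_sin, ← Complex.ofReal_sin,
    Real.cos_sub]
  simp only [Complex.add_re, Complex.add_im, Complex.sub_re, Complex.sub_im, Complex.mul_re,
    Complex.mul_im, Complex.ofReal_re, Complex.ofReal_im, Complex.I_re, Complex.I_im]
  linear_combination (sq_nonneg (a - b)) - a ^ 2 * Real.sin_sq_add_cos_sq X -
    b ^ 2 * Real.sin_sq_add_cos_sq Y

theorem one_sub_cos_one_pos : 0 < 1 - Real.cos 1 := by
  have := Real.cos_one_le
  linarith

/-- On the band `R ≤ ξ ≤ 2R` with `R = 1/(2π|x-y|)`, the phase gap `2πξ|x-y|` lies in `[1,2] ⊆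
[0,π]`, whence the factor `1 - cos 1`. There `|2πξ|^α |x-y|^α ≤ 2^α ≤ 4`, and both times are at most
`2|x-y|^α`, so each symbol has modulus at least `e⁻⁸`. -/
theorem le_lintegral_greenKernel_sub_sq {α τ h x y : ℝ} (hα : 0 < α) (hα₂ : α ≤ 2) (hτ : 0 < τ)
    (hh : 0 ≤ h) (hxy : x ≠ y) (hτz : τ ≤ |x - y| ^ α) (hhz : h ≤ |x - y| ^ α) :
    ENNReal.ofReal (Real.exp (-16) * (1 - Real.cos 1) / Real.pi * |x - y|⁻¹) ≤
      ∫⁻ v, ‖greenKernel α (τ + h) (x - v) - greenKernel α τ (y - v)‖ₑ ^ 2 := by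
  have hpi := Real.pi_pos
  have hz : 0 < |x - y| := abs_pos.2 (sub_ne_zero.2 hxy)
  rw [lintegral_greenKernel_sub_sq hα (by positivity) hτ]
  set R := (2 * Real.pi * |x - y|)⁻¹ with hR
  have hRz : 2 * Real.pi * R * |x - y| = 1 := by
    rw [hR]; field_simp
  have hRpos : 0 < R := by positivity
  have hb := const_mul_measure_le_lintegral (μ := volume) (A := Icc R (2 * R))
    (f := fun ξ => ‖greenSymbol α (τ + h) x ξ - greenSymbol α τ y ξ‖ₑ ^ 2)
    (c := ENNReal.ofReal (2 * Real.exp (-16) * (1 - Real.cos 1)))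
    measurableSet_Icc fun ξ hξ => ?_
  · refine le_trans (le_of_eq ?_) hb
    have := one_sub_cos_one_pos
    rw [Real.volume_Icc, ← ENNReal.ofReal_mul (by positivity), hR]
    congr 1
    field_simp
    ring
  · refine ofReal_le_enorm_sq ?_
    have hξ0 : 0 < ξ := hRpos.trans_le hξ.1
    have hΛ : |2 * Real.pi * ξ| ^ α * |x - y| ^ α ≤ 4 := by
      rw [← Real.mul_rpow (abs_nonneg _) (abs_nonneg _)]
      have h1 : |2 * Real.pi * ξ| * |x - y| ≤ 2 := by
        rw [abs_of_pos (by positivity)]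
        calc 2 * Real.pi * ξ * |x - y| ≤ 2 * Real.pi * (2 * R) * |x - y| := by
              gcongr; exact hξ.2
          _ = 2 := by linarith
      calc (|2 * Real.pi * ξ| * |x - y|) ^ α ≤ 2 ^ α := by gcongr
        _ ≤ 2 ^ (2 : ℝ) := Real.rpow_le_rpow_of_exponent_le one_le_two hα₂
        _ = 4 := by norm_num
    have hbd : ∀ u : ℝ, u ≤ 2 * |x - y| ^ α →
        Real.exp (-8) ≤ Real.exp (-(u * |2 * Real.pi * ξ| ^ α)) := by
      intro u hu
      rw [Real.exp_le_exp]
      have := mul_le_mul_of_nonneg_right hu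
        (Real.rpow_nonneg (abs_nonneg (2 * Real.pi * ξ)) α)
      nlinarith
    have hzα : 0 ≤ |x - y| ^ α := by positivity
    have ha := hbd (τ + h) (by linarith)
    have hb := hbd τ (by linarith)
    refine le_trans ?_ (le_norm_exp_mul_sub_sq _ _ _ _)
    have hcos : Real.cos (2 * Real.pi * ξ * x - 2 * Real.pi * ξ * y) ≤ Real.cos 1 := by
      rw [← Real.cos_abs, ← mul_sub, abs_mul, abs_of_pos (by positivity : 0 < 2 * Real.pi * ξ)]
      refine Real.cos_le_cos_of_nonneg_of_le_pi zero_le_one ?_ ?_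
      · calc 2 * Real.pi * ξ * |x - y| ≤ 2 * Real.pi * (2 * R) * |x - y| := by
              gcongr; exact hξ.2
          _ = 2 := by linarith
          _ ≤ Real.pi := Real.two_le_pi
      · rw [← hRz]
        gcongr
        exact hξ.1
    have h16 : Real.exp (-16) = Real.exp (-8) * Real.exp (-8) := by
      rw [← Real.exp_add]; norm_num
    have h8 := Real.exp_pos (-8)
    have := one_sub_cos_one_pos
    rw [h16, ← mul_assoc]
    gcongr

/-! ### Lower bounds for the variance of the increments. -/

/-- The kernel whose stochastic integral is the solution of the linear equation at `(t, x)`. -/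
def heatIntegrand (α t x : ℝ) (z : ℝ × ℝ) : ℝ :=
  if z.1 < t then greenKernel α (t - z.1) (x - z.2) else 0

theorem measurable_heatIntegrand (α t x : ℝ) : Measurable (heatIntegrand α t x) := by
  unfold heatIntegrand
  refine Measurable.ite (measurableSet_lt measurable_fst measurable_const) ?_ measurable_const
  exact (measurable_greenKernel α).comp
    (f := fun z : ℝ × ℝ => (t - z.1, x - z.2)) (by fun_prop)

theorem mul_volume_le_lintegral_strip {T : ℝ} {f : ℝ × ℝ → ℝ≥0∞} (hf : Measurable f) {J : Set ℝ}
    (hJ : MeasurableSet J) (hJT : J ⊆ Icc 0 T) {c : ℝ≥0∞} (h : ∀ r ∈ J, c ≤ ∫⁻ v, f (r, v)) :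
    c * volume J ≤ ∫⁻ z in strip T, f z := by
  calc c * volume J = ∫⁻ _ in J, c := by simp
    _ ≤ ∫⁻ r in J, ∫⁻ v, f (r, v) := setLIntegral_mono' hJ h
    _ = ∫⁻ z in J ×ˢ univ, f z := by
      rw [Measure.volume_eq_prod, ← Measure.prod_restrict, Measure.restrict_univ,
        lintegral_prod _ hf.aemeasurable]
    _ ≤ ∫⁻ z in strip T, f z := lintegral_mono_set (prod_mono hJT subset_rfl)

/-- For `r` in `(s,t)` the kernel at `(s,y)` vanishes and `t - r ≤ t - s`. The length of the
interval raises the exponent `-1/α` by one. -/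
theorem le_lintegral_heatIntegrand_time {α s t T : ℝ} (hα : 0 < α) (hs : 0 ≤ s) (hst : s ≤ t)
    (htT : t ≤ T) (hα₁ : 1 < α) (x y : ℝ) :
    ENNReal.ofReal (Real.exp (-2) / Real.pi * |t - s| ^ ((α - 1) / α)) ≤
      ∫⁻ z in strip T, ‖heatIntegrand α t x z - heatIntegrand α s y z‖ₑ ^ 2 := by
  rcases hst.eq_or_lt with rfl | hst
  · have : (α - 1) / α ≠ 0 := (div_pos (by linarith) hα).ne'
    simp [Real.zero_rpow this]
  have hd : 0 < t - s := sub_pos.2 hst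
  refine le_trans (le_of_eq ?_) (mul_volume_le_lintegral_strip
    (((measurable_heatIntegrand α t x).sub (measurable_heatIntegrand α s y)).enorm.pow_const 2)
    (measurableSet_Ioo (a := s) (b := t)) (fun r hr => ⟨hs.trans hr.1.le, hr.2.le.trans htT⟩)
    (c := ENNReal.ofReal (Real.exp (-2) / Real.pi * (t - s) ^ (-1 / α))) fun r hr => ?_)
  · rw [Real.volume_Ioo, ← ENNReal.ofReal_mul (by positivity), abs_of_pos hd, mul_assoc,
      ← Real.rpow_add_one hd.ne']
    congr 3
    field_simp
    ring
  · simp only [heatIntegrand, if_pos hr.2, if_neg (not_lt.2 hr.1.le), sub_zero, Pi.sub_apply]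
    exact le_lintegral_greenKernel_sq hα (sub_pos.2 hr.2) (by linarith [hr.1]) x

/-- The window is `s - δ|x-y|^α < r < s`: `hδs` keeps it inside `[0,T]`, and `hδ₁` keeps `s - r`
below `|x-y|^α`. -/
theorem le_lintegral_heatIntegrand_space {α s t T δ x y : ℝ} (hα : 0 < α) (hα₂ : α ≤ 2)
    (hst : s ≤ t) (htT : t ≤ T) (hα₁ : 1 < α) (hδ₁ : δ ≤ 1)
    (hδs : δ * |x - y| ^ α ≤ s) (htz : t - s ≤ |x - y| ^ α) :
    ENNReal.ofReal (δ * (Real.exp (-16) * (1 - Real.cos 1) / Real.pi) * |x - y| ^ (α - 1)) ≤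
      ∫⁻ z in strip T, ‖heatIntegrand α t x z - heatIntegrand α s y z‖ₑ ^ 2 := by
  rcases eq_or_ne x y with rfl | hxy
  · simp [Real.zero_rpow (by linarith : α - 1 ≠ 0)]
  have hz : 0 < |x - y| := abs_pos.2 (sub_ne_zero.2 hxy)
  have hc := one_sub_cos_one_pos
  have hpi := Real.pi_pos
  refine le_trans (le_of_eq ?_) (mul_volume_le_lintegral_strip
    (((measurable_heatIntegrand α t x).sub (measurable_heatIntegrand α s y)).enorm.pow_const 2)
    (measurableSet_Ioo (a := s - δ * |x - y| ^ α) (b := s))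
    (fun r hr => ⟨by linarith [hr.1], by linarith [hr.2]⟩)
    (c := ENNReal.ofReal (Real.exp (-16) * (1 - Real.cos 1) / Real.pi * |x - y|⁻¹))
    fun r hr => ?_)
  · rw [Real.volume_Ioo, ← ENNReal.ofReal_mul (by positivity), Real.rpow_sub_one hz.ne']
    congr 1
    field_simp
    ring
  · have hrt : r < t := hr.2.trans_le hst
    simp only [heatIntegrand, if_pos hr.2, if_pos hrt, Pi.sub_apply]
    have key := le_lintegral_greenKernel_sub_sq (τ := s - r) (h := t - s) hα hα₂
      (sub_pos.2 hr.2) (sub_nonneg.2 hst) hxy ?_ htz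
    · simpa using key
    · have : δ * |x - y| ^ α ≤ 1 * |x - y| ^ α := by gcongr
      linarith [hr.1]

/-- Lower bound for the variance of the increments of the linear equation, with a constant that does
not depend on the time horizon `T`. -/
theorem exists_le_lintegral_heatIntegrand {α : ℝ} (hα₁ : 1 < α) (hα₂ : α ≤ 2) {t₀ : ℝ}
    (ht₀ : 0 < t₀) (D : ℝ) :
    ∃ c : ℝ, 0 < c ∧ ∀ T s t x y : ℝ, t₀ ≤ s → s ≤ t → t ≤ T → |x - y| ≤ D →
      ENNReal.ofReal (c * (|t - s| ^ ((α - 1) / α) + |x - y| ^ (α - 1))) ≤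
        ∫⁻ z in strip T, ‖heatIntegrand α t x z - heatIntegrand α s y z‖ₑ ^ 2 := by
  have hα : 0 < α := by linarith
  have hpi := Real.pi_pos
  have hc := one_sub_cos_one_pos
  -- The maximum with `1` makes `M` positive, since `D` may be negative when no pair `x, y` is
  -- concerned.
  set M := max D 1 with hM
  have hM1 : 1 ≤ M := le_max_right _ _
  -- Chosen so that `δ|x-y|^α ≤ t₀ ≤ s`.
  set δ := min 1 (t₀ / M ^ α) with hδ
  have hδ0 : 0 < δ := lt_min one_pos (by positivity)
  set A := Real.exp (-2) / Real.pi with hA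
  set B := δ * (Real.exp (-16) * (1 - Real.cos 1) / Real.pi) with hB
  have hA0 : 0 < A := by positivity
  have hB0 : 0 < B := by positivity
  -- The factor `1/2` comes from bounding the larger of two terms below by their average.
  refine ⟨min A B / 2, by positivity, fun T s t x y hs hst htT hxy => ?_⟩
  have hs0 : 0 ≤ s := ht₀.le.trans hs
  have hd : |t - s| = t - s := abs_of_nonneg (sub_nonneg.2 hst)
  have hH : 0 ≤ |t - s| ^ ((α - 1) / α) := by positivity
  have hZ : 0 ≤ |x - y| ^ (α - 1) := by positivity
  have hminA := min_le_left A B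
  have hminB := min_le_right A B
  have hmin : 0 < min A B := lt_min hA0 hB0
  have htime := le_lintegral_heatIntegrand_time hα hs0 hst htT hα₁ x y
  rcases le_total (t - s) (|x - y| ^ α) with h | h
  · have hspace := le_lintegral_heatIntegrand_space hα hα₂ hst htT hα₁ (min_le_left 1 (t₀ / M ^ α))
      (x := x) (y := y) ?_ h
    · refine le_trans (ENNReal.ofReal_le_ofReal ?_) ((ENNReal.ofReal_max _ _).trans_le
        (max_le htime hspace))
      rw [← hA, ← hB]
      have h1 := le_max_left (A * |t - s| ^ ((α - 1) / α)) (B * |x - y| ^ (α - 1))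
      have h2 := le_max_right (A * |t - s| ^ ((α - 1) / α)) (B * |x - y| ^ (α - 1))
      nlinarith
    · calc δ * |x - y| ^ α ≤ t₀ / M ^ α * M ^ α := by
            gcongr
            · exact min_le_right _ _
            · exact hxy.trans (le_max_left _ _)
        _ = t₀ := by field_simp
        _ ≤ s := hs
  · refine le_trans (ENNReal.ofReal_le_ofReal ?_) htime
    have hZH : |x - y| ^ (α - 1) ≤ |t - s| ^ ((α - 1) / α) := by
      calc |x - y| ^ (α - 1) = (|x - y| ^ α) ^ ((α - 1) / α) := by
            rw [← Real.rpow_mul (abs_nonneg _), mul_div_cancel₀ _ hα.ne']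
        _ ≤ |t - s| ^ ((α - 1) / α) := by
            rw [hd]
            exact Real.rpow_le_rpow (by positivity) h (div_nonneg (by linarith) hα.le)
    rw [← hA]
    nlinarith

/-! ### Independence, `L²` limits and Gaussian moments. -/

/-- Independence is not affected by augmenting one of the σ-fields by the null sets. -/
theorem indep_sup_generateFrom_null {Ω : Type*} {m₁ m₂ m : MeasurableSpace Ω} {P : Measure Ω}
    (h : Indep m₁ m₂ P) :
    Indep (m₁ ⊔ MeasurableSpace.generateFrom {N : Set Ω | MeasurableSet N ∧ P N = 0}) m₂ P := by
  -- Every set of the augmented σ-field agrees almost everywhere with a set of `m₁`.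
  have hle : m₁ ⊔ MeasurableSpace.generateFrom {N : Set Ω | MeasurableSet N ∧ P N = 0} ≤
      eventuallyMeasurableSpace m₁ (ae P) := by
    refine sup_le le_eventuallyMeasurableSpace (MeasurableSpace.generateFrom_le fun N hN => ?_)
    exact ⟨∅, @MeasurableSet.empty _ m₁, ae_eq_empty.2 hN.2⟩
  rw [Indep_iff] at h ⊢
  intro A B hA hB
  obtain ⟨A', hA', hAA'⟩ := hle A hA
  rw [measure_congr (hAA'.inter (ae_eq_refl B)), measure_congr hAA', h A' B hA' hB]

theorem eLpNorm_two_eq_ofReal_sqrt {β : Type*} [MeasurableSpace β] {μ : Measure β} {f : β → ℝ}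
    (hf : MemLp f 2 μ) : eLpNorm f 2 μ = ENNReal.ofReal √(∫ x, f x ^ 2 ∂μ) := by
  rw [hf.eLpNorm_eq_integral_rpow_norm two_ne_zero ENNReal.ofNat_ne_top, Real.sqrt_eq_rpow]
  simp

theorem integral_sum_sq {β ι : Type*} [MeasurableSpace β] [Fintype ι] {μ : Measure β}
    {f : ι → β → ℝ} (hf : ∀ k, MemLp (f k) 2 μ) :
    ∫ x, (∑ k, f k x) ^ 2 ∂μ = ∑ k, ∑ l, ∫ x, f k x * f l x ∂μ := by
  have hi : ∀ k l, Integrable (fun x => f k x * f l x) μ := fun k l =>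
    (hf k).integrable_mul (hf l)
  simp_rw [sq, Finset.sum_mul_sum]
  rw [integral_finsetSum _ fun k _ => integrable_finsetSum _ fun l _ => hi k l]
  exact Finset.sum_congr rfl fun k _ => integral_finsetSum _ fun l _ => hi k l

theorem eLpNorm_two_sq {β E : Type*} [MeasurableSpace β] [NormedAddCommGroup E] (μ : Measure β)
    (f : β → E) : eLpNorm f 2 μ ^ 2 = ∫⁻ x, ‖f x‖ₑ ^ 2 ∂μ := by
  have := eLpNorm_nnreal_pow_eq_lintegral (μ := μ) (f := f) (p := 2) two_ne_zero
  simpa using this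

theorem enorm_integral_sq_le {Ω : Type*} [MeasurableSpace Ω] {P : Measure Ω}
    [IsProbabilityMeasure P] {f : Ω → ℝ} (hf : AEStronglyMeasurable f P) :
    ‖∫ ω, f ω ∂P‖ₑ ^ 2 ≤ ∫⁻ ω, ‖f ω‖ₑ ^ 2 ∂P := by
  rw [← eLpNorm_two_sq]
  gcongr
  refine (enorm_integral_le_lintegral_enorm f).trans ?_
  rw [← eLpNorm_one_eq_lintegral_enorm]
  exact eLpNorm_le_eLpNorm_of_exponent_le one_le_two hf

theorem tendsto_eLpNorm_of_tendsto_sub {β : Type*} [MeasurableSpace β] {μ : Measure β}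
    {f : ℕ → β → ℝ} {g : β → ℝ} (hf : ∀ n, MemLp (f n) 2 μ) (hg : MemLp g 2 μ)
    (h : Tendsto (fun n => eLpNorm (f n - g) 2 μ) atTop (𝓝 0)) :
    Tendsto (fun n => eLpNorm (f n) 2 μ) atTop (𝓝 (eLpNorm g 2 μ)) := by
  have h1 : Tendsto (fun n => eLpNorm g 2 μ - eLpNorm (f n - g) 2 μ) atTop
      (𝓝 (eLpNorm g 2 μ)) := by
    simpa using ENNReal.Tendsto.sub tendsto_const_nhds h (Or.inl hg.2.ne)
  have h2 : Tendsto (fun n => eLpNorm g 2 μ + eLpNorm (f n - g) 2 μ) atTop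
      (𝓝 (eLpNorm g 2 μ)) := by
    simpa using tendsto_const_nhds.add h
  refine tendsto_of_tendsto_of_tendsto_of_le_of_le h1 h2 (fun n => ?_) (fun n => ?_)
  · refine tsub_le_iff_right.2 ?_
    have := eLpNorm_sub_le (p := 2) (hf n).1 ((hf n).sub hg).1 one_le_two
    simpa using this
  · have := eLpNorm_add_le (p := 2) hg.1 ((hf n).sub hg).1 one_le_two
    simpa using this

/-- An `L²` limit of centered Gaussian variables is centered Gaussian. -/
theorem map_eq_gaussianReal_of_tendsto {Ω : Type*} [MeasurableSpace Ω] {P : Measure Ω}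
    [IsProbabilityMeasure P] {X : ℕ → Ω → ℝ} {Y : Ω → ℝ} (hX : ∀ n, HasGaussianLaw (X n) P)
    (hX₀ : ∀ n, ∫ ω, X n ω ∂P = 0) (hY : MemLp Y 2 P)
    (h : Tendsto (fun n => eLpNorm (X n - Y) 2 P) atTop (𝓝 0)) :
    P.map Y = gaussianReal 0 ((eLpNorm Y 2 P).toNNReal ^ 2) := by
  have hX2 : ∀ n, MemLp (X n) 2 P := fun n => (hX n).memLp_two
  have hmap : ∀ n, P.map (X n) = gaussianReal 0 ((eLpNorm (X n) 2 P).toNNReal ^ 2) := by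
    intro n
    rw [(hX n).map_eq_gaussianReal, hX₀ n]
    congr 1
    rw [variance_of_integral_eq_zero (hX n).aemeasurable (hX₀ n),
      eLpNorm_two_eq_ofReal_sqrt (hX2 n)]
    have : 0 ≤ ∫ ω, X n ω ^ 2 ∂P := integral_nonneg fun ω => sq_nonneg _
    ext
    rw [NNReal.coe_pow, ENNReal.coe_toNNReal_eq_toReal, ENNReal.toReal_ofReal (Real.sqrt_nonneg _),
      Real.sq_sqrt this, Real.coe_toNNReal _ this]
  have hlim : Tendsto (fun n => (eLpNorm (X n) 2 P).toNNReal ^ 2) atTop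
      (𝓝 ((eLpNorm Y 2 P).toNNReal ^ 2)) :=
    ((ENNReal.tendsto_toNNReal hY.2.ne).comp (tendsto_eLpNorm_of_tendsto_sub hX2 hY h)).pow 2
  have hdist := (tendstoInMeasure_of_tendsto_eLpNorm two_ne_zero (fun n => (hX2 n).1) hY.1
    h).tendstoInDistribution (fun n => (hX n).aemeasurable)
  have : IsProbabilityMeasure (P.map Y) := Measure.isProbabilityMeasure_map hY.1.aemeasurable
  -- The characteristic functions of `X n` converge to that of `Y` and, since the variances
  -- converge, to the Gaussian one. A zero limit variance is included.
  refine Measure.ext_of_charFun (funext fun u => ?_)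
  have hc := ProbabilityMeasure.tendsto_iff_tendsto_charFun.1 hdist.tendsto u
  simp only [ProbabilityMeasure.coe_mk, hmap, charFun_gaussianReal] at hc
  refine tendsto_nhds_unique hc ?_
  rw [charFun_gaussianReal]
  refine (Complex.continuous_exp.tendsto _).comp (tendsto_const_nhds.sub ?_)
  refine Tendsto.div_const (Tendsto.mul_const _ ?_) _
  exact (Complex.continuous_ofReal.tendsto _).comp ((NNReal.continuous_coe.tendsto _).comp hlim)

/-- Absolute moments of centered Gaussian variables. -/
theorem integral_abs_rpow_of_map_eq_gaussianReal {Ω : Type*} [MeasurableSpace Ω] {P : Measure Ω}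
    {Y : Ω → ℝ} (hY : AEMeasurable Y P) {s : ℝ≥0} (h : P.map Y = gaussianReal 0 (s ^ 2)) (p : ℝ) :
    ∫ ω, |Y ω| ^ p ∂P = (s : ℝ) ^ p * ∫ x, |x| ^ p ∂(gaussianReal 0 1) := by
  have hm : Measurable fun x : ℝ => |x| ^ p := by fun_prop
  have hs : gaussianReal 0 (s ^ 2) = (gaussianReal 0 1).map ((s : ℝ) * ·) := by
    rw [gaussianReal_map_const_mul, mul_zero, mul_one]
    congr 1
  rw [← integral_map (f := fun x : ℝ => |x| ^ p) hY hm.aestronglyMeasurable, h, hs,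
    integral_map (by fun_prop) hm.aestronglyMeasurable, ← integral_const_mul]
  congr 1
  ext x
  rw [abs_mul, Real.mul_rpow (abs_nonneg _) (abs_nonneg _), NNReal.abs_eq]

theorem integral_abs_rpow_gaussianReal_pos {p : ℝ} (hp : 0 < p) :
    0 < ∫ x, |x| ^ p ∂(gaussianReal 0 1) := by
  have hint : Integrable (fun x : ℝ => |x| ^ p) (gaussianReal 0 1) := by
    have := (memLp_id_gaussianReal (μ := 0) (v := 1) p.toNNReal).integrable_norm_rpow'
    simpa [Real.coe_toNNReal _ hp.le] using this
  rw [integral_pos_iff_support_of_nonneg (fun x => by positivity) hint]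
  have : Function.support (fun x : ℝ => |x| ^ p) = {0}ᶜ := by
    ext x
    simp [Function.mem_support, Real.rpow_eq_zero (abs_nonneg x) hp.ne']
  have := nullSingletonClass_gaussianReal (μ := 0) (v := 1) one_ne_zero
  rw [‹Function.support _ = _›, prob_compl_eq_one_sub (measurableSet_singleton _),
    measure_singleton]
  simp

/-! ### White noise: independence and additivity. -/

variable {Ω : Type*} [MeasurableSpace Ω] {d : ℕ} {P : Measure Ω} {T : ℝ}
  {W : Fin d → Set (ℝ × ℝ) → Ω → ℝ}

theorem strip_mono {a b : ℝ} (h : a ≤ b) : strip a ⊆ strip b :=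
  prod_mono (Icc_subset_Icc_right h) subset_rfl

theorem noiseSigma_mono {a b : ℝ} (h : a ≤ b) : noiseSigma P T W a ≤ noiseSigma P T W b := by
  refine sup_le_sup_right (iSup_le fun j => iSup_le fun A => iSup_le fun hA => ?_) _
  exact le_iSup_of_le j (le_iSup_of_le A (le_iSup_of_le (hA.trans (strip_mono h)) le_rfl))

theorem measurable_noiseSigma (j : Fin d) (A : NoiseSet T) {a : ℝ}
    (hA : (A : Set (ℝ × ℝ)) ⊆ strip a) : Measurable[noiseSigma P T W a] (W j A) := by
  refine Measurable.mono (comap_measurable _) ?_ le_rfl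
  exact le_sup_of_le_left (le_iSup_of_le j (le_iSup_of_le A (le_iSup_of_le hA le_rfl)))

namespace IsWhiteNoise

theorem noiseSigma_le (hW : IsWhiteNoise P T W) (a : ℝ) :
    noiseSigma P T W a ≤ ‹MeasurableSpace Ω› :=
  sup_le (iSup_le fun j => iSup_le fun A => iSup_le fun _ => (hW.measurable j A).comap_le)
    (MeasurableSpace.generateFrom_le fun _ hN => hN.1)

theorem memLp_two (hW : IsWhiteNoise P T W) (j : Fin d) (A : NoiseSet T) : MemLp (W j A) 2 P :=
  (hW.gaussian.hasGaussianLaw_eval (j, A)).memLp_two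

theorem integrable (hW : IsWhiteNoise P T W) (j : Fin d) (A : NoiseSet T) :
    Integrable (W j A) P :=
  (hW.gaussian.hasGaussianLaw_eval (j, A)).integrable

theorem integrable_mul (hW : IsWhiteNoise P T W) (j k : Fin d) (A B : NoiseSet T) :
    Integrable (fun ω => W j A ω * W k B ω) P :=
  (hW.memLp_two j A).integrable_mul (hW.memLp_two k B)

/-- The noise after time `a` is independent of `𝓕_a`. -/
theorem indepFun (hW : IsWhiteNoise P T W) [IsProbabilityMeasure P] {a : ℝ} {E : Type*}
    [MeasurableSpace E] {X : Ω → E} (hX : Measurable[noiseSigma P T W a] X) (j : Fin d)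
    (A B : NoiseSet T) (hA : (A : Set (ℝ × ℝ)) ⊆ Ioi a ×ˢ univ)
    (hB : (B : Set (ℝ × ℝ)) ⊆ Ioi a ×ˢ univ) :
    IndepFun X (fun ω => (W j A ω, W j B ω)) P := by
  let past := {q : Fin d × NoiseSet T // (q.2 : Set (ℝ × ℝ)) ⊆ strip a}
  let future := {q : Fin d × NoiseSet T // (q.2 : Set (ℝ × ℝ)) ⊆ Ioi a ×ˢ univ}
  let Y : past → Ω → ℝ := fun q => W q.1.1 q.1.2
  let Z : future → Ω → ℝ := fun q => W q.1.1 q.1.2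
  have hYZ : IsGaussianProcess (Sum.elim Y Z) P := by
    have h := hW.gaussian.comp_right
      (Sum.elim (Subtype.val : past → _) (Subtype.val : future → _))
    have e : Sum.elim Y Z = (fun (q : Fin d × NoiseSet T) (ω : Ω) => W q.1 q.2 ω) ∘
        Sum.elim (Subtype.val : past → _) (Subtype.val : future → _) := by
      ext (q | q) ω <;> rfl
    rw [e]
    exact h
  -- Jointly Gaussian uncorrelated families are independent; past and future sets are disjoint
  -- because the past includes time `a` and the future excludes it.
  have hind := hYZ.indepFun_of_covariance_eq_zero (fun q => (hW.measurable _ _).aemeasurable)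
    (fun q => (hW.measurable _ _).aemeasurable) fun q r => by
      have hdisj : (q.1.2 : Set (ℝ × ℝ)) ∩ r.1.2 = ∅ := by
        ext z
        simp only [mem_inter_iff, mem_empty_iff_false, iff_false, not_and]
        intro h1 h2
        exact absurd (q.2 h1).1.2 (not_le.2 (r.2 h2).1)
      rw [covariance_eq_sub (hW.memLp_two _ _) (hW.memLp_two _ _)]
      have h := hW.covariance q.1.1 r.1.1 q.1.2 r.1.2
      rw [hdisj, measure_empty, ENNReal.toReal_zero, ite_self] at h
      simp only [Pi.mul_apply, hW.mean_zero, h, mul_zero, sub_zero]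
  have hindep := indep_sup_generateFrom_null (IndepFun_iff_Indep _ _ _ |>.1 hind)
  rw [IndepFun_iff_Indep]
  refine indep_of_indep_of_le_left (indep_of_indep_of_le_right hindep ?_) (hX.comap_le.trans ?_)
  · refine Measurable.comap_le (Measurable.prodMk ?_ ?_)
    · exact (measurable_pi_apply (X := fun _ : future => ℝ) ⟨(j, A), hA⟩).comp
        (comap_measurable fun ω q => Z q ω)
    · exact (measurable_pi_apply (X := fun _ : future => ℝ) ⟨(j, B), hB⟩).comp
        (comap_measurable fun ω q => Z q ω)
  · refine sup_le_sup_right (iSup_le fun k => iSup_le fun C => iSup_le fun hC => ?_) _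
    refine Measurable.comap_le ?_
    exact (measurable_pi_apply (X := fun _ : past => ℝ) ⟨(k, C), hC⟩).comp
      (comap_measurable fun ω q => Y q ω)

/-- Additivity is not an axiom of the noise but follows from its covariance: expanding the second
moment of `W(C) - W(A) - W(B)` gives `|C| + |A| + |B| - 2|A| - 2|B| = 0`. -/
theorem ae_eq_add (hW : IsWhiteNoise P T W) (j : Fin d) (A B C : NoiseSet T)
    (hC : (C : Set (ℝ × ℝ)) = (A : Set (ℝ × ℝ)) ∪ B) (hd : Disjoint (A : Set (ℝ × ℝ)) B) :
    W j C =ᵐ[P] W j A + W j B := by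
  have hsq : ∀ ω, (W j C ω - (W j A ω + W j B ω)) ^ 2 = W j C ω * W j C ω + W j A ω * W j A ω +
      W j B ω * W j B ω + 2 * (W j A ω * W j B ω) - 2 * (W j C ω * W j A ω) -
      2 * (W j C ω * W j B ω) := fun ω => by ring
  have hfin : ∀ D : NoiseSet T, volume (D : Set (ℝ × ℝ)) ≠ ∞ := fun D => D.2.2.2.ne
  have hI : ∫ ω, (W j C ω - (W j A ω + W j B ω)) ^ 2 ∂P = 0 := by
    simp_rw [hsq]
    have i1 := hW.integrable_mul j j C C
    have i2 := hW.integrable_mul j j A A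
    have i3 := hW.integrable_mul j j B B
    have i4 := (hW.integrable_mul j j A B).const_mul 2
    have i5 := (hW.integrable_mul j j C A).const_mul 2
    have i6 := (hW.integrable_mul j j C B).const_mul 2
    rw [integral_sub ?_ i6, integral_sub ?_ i5, integral_add ?_ i4, integral_add ?_ i3,
      integral_add i1 i2, integral_const_mul, integral_const_mul, integral_const_mul,
      hW.covariance, hW.covariance, hW.covariance, hW.covariance, hW.covariance, hW.covariance]
    rotate_left
    · exact i1.add i2
    · exact (i1.add i2).add i3
    · exact ((i1.add i2).add i3).add i4
    · exact (((i1.add i2).add i3).add i4).sub i5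
    simp only [if_true, inter_self]
    rw [hd.inter_eq, hC, union_inter_cancel_left, union_inter_cancel_right,
      measure_union hd B.2.1, ENNReal.toReal_add (hfin A) (hfin B), measure_empty,
      ENNReal.toReal_zero]
    ring
  have hm : MemLp (fun ω => W j C ω - (W j A ω + W j B ω)) 2 P :=
    (hW.memLp_two j C).sub ((hW.memLp_two j A).add (hW.memLp_two j B))
  rw [integral_eq_zero_iff_of_nonneg (fun ω => sq_nonneg _) hm.integrable_sq] at hI
  filter_upwards [hI] with ω hω
  have := pow_eq_zero_iff two_ne_zero |>.1 hω
  simp only [Pi.add_apply]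
  linarith

/-- If `Y` is bounded and `𝓕_a`-measurable and `B` lies after time `a`, then
`E[Y W(A) W(B)] = E[Y] |A ∩ B|`. -/
theorem integral_mul_mul (hW : IsWhiteNoise P T W) [IsProbabilityMeasure P] {a : ℝ} {Y : Ω → ℝ}
    (hY : Measurable[noiseSigma P T W a] Y) {c : ℝ} (hYc : ∀ ω, |Y ω| ≤ c) (j : Fin d)
    (A B : NoiseSet T) (hB : (B : Set (ℝ × ℝ)) ⊆ Ioi a ×ˢ univ) :
    ∫ ω, Y ω * (W j A ω * W j B ω) ∂P =
      (∫ ω, Y ω ∂P) * (volume ((A : Set (ℝ × ℝ)) ∩ B)).toReal := by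
  have hms : MeasurableSet (strip a) := measurableSet_Icc.prod MeasurableSet.univ
  have hYm : Measurable Y := hY.mono (hW.noiseSigma_le a) le_rfl
  -- `A` is cut at time `a`. On the earlier part, `Y W(A₁)` is `𝓕_a`-measurable, hence independent
  -- of the centered `W(B)`, and contributes nothing. On the later part, `Y` is independent of the
  -- pair `(W(A₂), W(B))`.
  let A₁ : NoiseSet T := ⟨A ∩ strip a, A.2.1.inter hms, inter_subset_left.trans A.2.2.1,
    (measure_mono inter_subset_left).trans_lt A.2.2.2⟩
  let A₂ : NoiseSet T := ⟨A \ strip a, A.2.1.diff hms, sdiff_subset.trans A.2.2.1,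
    (measure_mono sdiff_subset).trans_lt A.2.2.2⟩
  have hA₂ : (A₂ : Set (ℝ × ℝ)) ⊆ Ioi a ×ˢ univ := by
    rintro z ⟨hz, hz'⟩
    refine ⟨?_, trivial⟩
    by_contra h
    exact hz' ⟨⟨(A.2.2.1 hz).1.1, not_lt.1 h⟩, trivial⟩
  have hadd := hW.ae_eq_add j A₁ A₂ A (inter_union_sdiff _ _).symm
    (disjoint_left.2 fun z hz hz' => hz'.2 hz.2)
  have hint : ∀ D : NoiseSet T, Integrable (fun ω => Y ω * (W j D ω * W j B ω)) P := fun D =>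
    (hW.integrable_mul j j D B).bdd_mul (c := c) hYm.aestronglyMeasurable (ae_of_all _ hYc)
  have h1 : ∫ ω, Y ω * (W j A₁ ω * W j B ω) ∂P = 0 := by
    have hind := (hW.indepFun (X := fun ω => Y ω * W j A₁ ω)
      (hY.mul (measurable_noiseSigma j A₁ inter_subset_right)) j B B hB hB).comp
      measurable_id measurable_fst
    have := hind.integral_fun_mul_eq_mul_integral
      (hYm.mul (hW.measurable j A₁)).aestronglyMeasurable (hW.measurable j B).aestronglyMeasurable
    simp only [Function.comp_def, id, hW.mean_zero, mul_zero, mul_assoc] at this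
    exact this
  have h2 : ∫ ω, Y ω * (W j A₂ ω * W j B ω) ∂P =
      (∫ ω, Y ω ∂P) * (volume ((A₂ : Set (ℝ × ℝ)) ∩ B)).toReal := by
    have hind := (hW.indepFun hY j A₂ B hA₂ hB).comp measurable_id
      (measurable_fst.mul measurable_snd)
    have := hind.integral_fun_mul_eq_mul_integral hYm.aestronglyMeasurable
      ((hW.measurable j A₂).mul (hW.measurable j B)).aestronglyMeasurable
    have hcov := hW.covariance j j A₂ B
    rw [if_pos rfl] at hcov
    simp only [Function.comp_def, id, Pi.mul_apply] at this
    rw [this, hcov]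
  have hAB : (A₂ : Set (ℝ × ℝ)) ∩ B = (A : Set (ℝ × ℝ)) ∩ B := by
    ext z
    constructor
    · exact fun hz => ⟨hz.1.1, hz.2⟩
    · exact fun hz => ⟨⟨hz.1, fun h => absurd h.1.2 (not_le.2 (hB hz.2).1)⟩, hz.2⟩
  calc ∫ ω, Y ω * (W j A ω * W j B ω) ∂P
      = ∫ ω, Y ω * (W j A₁ ω * W j B ω) + Y ω * (W j A₂ ω * W j B ω) ∂P := by
        refine integral_congr_ae ?_
        filter_upwards [hadd] with ω hω
        rw [hω, Pi.add_apply]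
        ring
    _ = _ := by rw [integral_add (hint A₁) (hint A₂), h1, h2, hAB, zero_add]

end IsWhiteNoise

/-! ### Simple integrands and the Itô isometry. -/

namespace SimpleIntegrand

/-- The `k`-th rectangle of a simple integrand. -/
def rect (S : SimpleIntegrand P T W) (k : Fin S.n) : NoiseSet T :=
  ⟨Ioc (S.a k) (S.b k) ×ˢ S.A k, measurableSet_Ioc.prod (S.measurableSet_A k),
    prod_mono (fun _ hr => ⟨(S.a_nonneg k).trans hr.1.le, hr.2.trans (S.b_le k)⟩) (subset_univ _),
    by
      rw [Measure.volume_eq_prod, Measure.prod_prod, Real.volume_Ioc]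
      exact ENNReal.mul_lt_top ENNReal.ofReal_lt_top (S.volume_A k)⟩

theorem rect_subset (S : SimpleIntegrand P T W) (k : Fin S.n) :
    (S.rect k : Set (ℝ × ℝ)) ⊆ Ioi (S.a k) ×ˢ univ :=
  prod_mono Ioc_subset_Ioi_self (subset_univ _)

theorem eval_eq (S : SimpleIntegrand P T W) (q : (ℝ × ℝ) × Ω) :
    S.eval q = ∑ k, (S.rect k : Set (ℝ × ℝ)).indicator (fun _ => (1 : ℝ)) q.1 * S.X k q.2 :=
  Finset.sum_congr rfl fun _ _ => mul_comm _ _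

theorem integral_eq (S : SimpleIntegrand P T W) (j : Fin d) (ω : Ω) :
    S.integral j ω = ∑ k, S.X k ω * W j (S.rect k) ω := rfl


theorem measurable_coeff (S : SimpleIntegrand P T W) (hW : IsWhiteNoise P T W) (k : Fin S.n) :
    Measurable (S.X k) :=
  (S.measurable_X k).mono (hW.noiseSigma_le _) le_rfl

theorem memLp_coeff [IsProbabilityMeasure P] (S : SimpleIntegrand P T W)
    (hW : IsWhiteNoise P T W) (k : Fin S.n) (p : ℝ≥0∞) : MemLp (S.X k) p P := by
  obtain ⟨C, hC⟩ := S.bounded_X k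
  exact MemLp.of_bound (S.measurable_coeff hW k).aestronglyMeasurable C (ae_of_all _ hC)

theorem memLp_integral [IsProbabilityMeasure P] (S : SimpleIntegrand P T W)
    (hW : IsWhiteNoise P T W) (j : Fin d) : MemLp (S.integral j) 2 P := by
  refine memLp_finsetSum (f := fun k ω => S.X k ω * W j (S.rect k) ω) _ fun k _ => ?_
  exact (hW.memLp_two j (S.rect k)).mul (S.memLp_coeff hW k ∞)

theorem memLp_indicator_rect (S : SimpleIntegrand P T W) (k : Fin S.n) :
    MemLp ((S.rect k : Set (ℝ × ℝ)).indicator fun _ => (1 : ℝ)) 2 (volume.restrict (strip T)) :=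
  memLp_indicator_const 2 (S.rect k).2.1 1
    (Or.inr ((Measure.restrict_apply_le _ _).trans_lt (S.rect k).2.2.2).ne)

theorem memLp_term [IsProbabilityMeasure P] (S : SimpleIntegrand P T W)
    (hW : IsWhiteNoise P T W) (k : Fin S.n) : MemLp (fun q : (ℝ × ℝ) × Ω =>
      (S.rect k : Set (ℝ × ℝ)).indicator (fun _ => (1 : ℝ)) q.1 * S.X k q.2) 2
      ((volume.restrict (strip T)).prod P) := by
  obtain ⟨C, hC⟩ := S.bounded_X k
  have h : MemLp (fun q : (ℝ × ℝ) × Ω => S.X k q.2) ∞ ((volume.restrict (strip T)).prod P) :=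
    memLp_top_of_bound ((S.measurable_coeff hW k).comp measurable_snd).aestronglyMeasurable C
      (ae_of_all _ fun q => hC q.2)
  exact h.mul ((S.memLp_indicator_rect k).comp_fst P)

theorem memLp_eval [IsProbabilityMeasure P] (S : SimpleIntegrand P T W)
    (hW : IsWhiteNoise P T W) : MemLp S.eval 2 ((volume.restrict (strip T)).prod P) := by
  have : S.eval = fun q => ∑ k, (S.rect k : Set (ℝ × ℝ)).indicator (fun _ => (1 : ℝ)) q.1 *
      S.X k q.2 := funext S.eval_eq
  rw [this]
  refine memLp_finsetSum (f := fun k (q : (ℝ × ℝ) × Ω) =>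
    (S.rect k : Set (ℝ × ℝ)).indicator (fun _ => (1 : ℝ)) q.1 * S.X k q.2) _ fun k _ => ?_
  exact S.memLp_term hW k

/-- By symmetry the rectangle `l` may be taken to start last; both coefficients are then known at
time `S.a l`, after which `S.rect l` lies. -/
theorem integral_mul_noise [IsProbabilityMeasure P] (S : SimpleIntegrand P T W)
    (hW : IsWhiteNoise P T W) (j : Fin d) (k l : Fin S.n) :
    ∫ ω, S.X k ω * S.X l ω * (W j (S.rect k) ω * W j (S.rect l) ω) ∂P =
      (∫ ω, S.X k ω * S.X l ω ∂P) *
        (volume ((S.rect k : Set (ℝ × ℝ)) ∩ (S.rect l : Set (ℝ × ℝ)))).toReal := by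
  wlog h : S.a k ≤ S.a l generalizing k l
  · have := this l k (le_of_not_ge h)
    rw [inter_comm]
    simpa only [mul_comm] using this
  obtain ⟨C, hC⟩ := S.bounded_X k
  obtain ⟨D, hD⟩ := S.bounded_X l
  refine hW.integral_mul_mul (a := S.a l) (c := C * D)
    (((S.measurable_X k).mono (noiseSigma_mono h) le_rfl).mul (S.measurable_X l)) (fun ω => ?_) j
    (S.rect k) (S.rect l) (S.rect_subset l)
  rw [Pi.mul_apply, abs_mul]
  exact mul_le_mul (hC ω) (hD ω) (abs_nonneg _) ((abs_nonneg _).trans (hC ω))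

/-- The double sum is the one obtained in `integral_eval_sq`, which gives the isometry. -/
theorem integral_integral_sq [IsProbabilityMeasure P] (S : SimpleIntegrand P T W)
    (hW : IsWhiteNoise P T W) (j : Fin d) :
    ∫ ω, S.integral j ω ^ 2 ∂P = ∑ k, ∑ l, (∫ ω, S.X k ω * S.X l ω ∂P) *
      (volume ((S.rect k : Set (ℝ × ℝ)) ∩ (S.rect l : Set (ℝ × ℝ)))).toReal := by
  have hm : ∀ k, MemLp (fun ω => S.X k ω * W j (S.rect k) ω) 2 P := fun k =>
    (hW.memLp_two j (S.rect k)).mul (S.memLp_coeff hW k ∞)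
  simp_rw [integral_eq]
  rw [integral_sum_sq hm]
  refine Finset.sum_congr rfl fun k _ => Finset.sum_congr rfl fun l _ => ?_
  rw [← S.integral_mul_noise hW j k l]
  congr 1
  ext ω
  ring

theorem integral_eval_sq [IsProbabilityMeasure P] (S : SimpleIntegrand P T W)
    (hW : IsWhiteNoise P T W) :
    ∫ q, S.eval q ^ 2 ∂((volume.restrict (strip T)).prod P) =
      ∑ k, ∑ l, (∫ ω, S.X k ω * S.X l ω ∂P) *
        (volume ((S.rect k : Set (ℝ × ℝ)) ∩ (S.rect l : Set (ℝ × ℝ)))).toReal := by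
  simp_rw [eval_eq]
  rw [integral_sum_sq (S.memLp_term hW)]
  refine Finset.sum_congr rfl fun k _ => Finset.sum_congr rfl fun l _ => ?_
  have hms := (S.rect k).2.1.inter (S.rect l).2.1
  calc _ = ∫ q : (ℝ × ℝ) × Ω, ((S.rect k : Set (ℝ × ℝ)) ∩ (S.rect l : Set (ℝ × ℝ))).indicator
          (fun _ => (1 : ℝ)) q.1 * (S.X k q.2 * S.X l q.2) ∂((volume.restrict (strip T)).prod P) := by
        congr 1
        ext q
        have := inter_indicator_mul (s := (S.rect k : Set (ℝ × ℝ)))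
          (t := (S.rect l : Set (ℝ × ℝ))) (fun _ => (1 : ℝ)) (fun _ => (1 : ℝ)) q.1
        rw [mul_one] at this
        rw [this]
        ring
    _ = _ := by
        rw [integral_prod_mul (fun z => ((S.rect k : Set (ℝ × ℝ)) ∩
          (S.rect l : Set (ℝ × ℝ))).indicator (fun _ => (1 : ℝ)) z) (fun ω => S.X k ω * S.X l ω),
          integral_indicator_const _ hms, mul_comm]
        rw [Measure.real, Measure.restrict_apply hms,
          inter_eq_left.2 (inter_subset_left.trans (S.rect k).2.2.1), smul_eq_mul, mul_one]

/-- The Itô isometry for simple integrands. -/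
theorem eLpNorm_integral [IsProbabilityMeasure P] (S : SimpleIntegrand P T W)
    (hW : IsWhiteNoise P T W) (j : Fin d) :
    eLpNorm (S.integral j) 2 P = eLpNorm S.eval 2 ((volume.restrict (strip T)).prod P) := by
  rw [eLpNorm_two_eq_ofReal_sqrt (S.memLp_integral hW j),
    eLpNorm_two_eq_ofReal_sqrt (S.memLp_eval hW), S.integral_integral_sq hW, S.integral_eval_sq hW]

/-- The difference of two simple integrands. -/
def sub (S S' : SimpleIntegrand P T W) : SimpleIntegrand P T W where
  n := S.n + S'.n
  a := Fin.append S.a S'.a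
  b := Fin.append S.b S'.b
  A := Fin.append S.A S'.A
  X := Fin.append S.X (-S'.X)
  a_nonneg := Fin.addCases (by simpa using S.a_nonneg) (by simpa using S'.a_nonneg)
  a_le_b := Fin.addCases (by simpa using S.a_le_b) (by simpa using S'.a_le_b)
  b_le := Fin.addCases (by simpa using S.b_le) (by simpa using S'.b_le)
  measurableSet_A :=
    Fin.addCases (by simpa using S.measurableSet_A) (by simpa using S'.measurableSet_A)
  volume_A := Fin.addCases (by simpa using S.volume_A) (by simpa using S'.volume_A)
  measurable_X := by
    refine Fin.addCases (fun k => ?_) (fun k => ?_)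
    · rw [Fin.append_left, Fin.append_left]
      exact S.measurable_X k
    · rw [Fin.append_right, Fin.append_right]
      exact (S'.measurable_X k).neg
  bounded_X := Fin.addCases (by simpa using S.bounded_X) (by simpa using S'.bounded_X)

theorem eval_sub (S S' : SimpleIntegrand P T W) : (S.sub S').eval = S.eval - S'.eval := by
  ext q
  refine (Fin.sum_univ_add (a := S.n) (b := S'.n) _).trans ?_
  simp [eval, sub, sub_eq_add_neg]

theorem integral_sub (S S' : SimpleIntegrand P T W) (j : Fin d) :
    (S.sub S').integral j = S.integral j - S'.integral j := by
  ext ω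
  refine (Fin.sum_univ_add (a := S.n) (b := S'.n) _).trans ?_
  simp [integral, sub, sub_eq_add_neg]

/-- The deterministic simple integrand with the coefficients replaced by their means. -/
def mean (S : SimpleIntegrand P T W) : SimpleIntegrand P T W where
  n := S.n
  a := S.a
  b := S.b
  A := S.A
  X := fun k _ => ∫ ω, S.X k ω ∂P
  a_nonneg := S.a_nonneg
  a_le_b := S.a_le_b
  b_le := S.b_le
  measurableSet_A := S.measurableSet_A
  volume_A := S.volume_A
  measurable_X := fun _ => measurable_const
  bounded_X := fun _ => ⟨_, fun _ => le_rfl⟩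

theorem eval_mean [IsProbabilityMeasure P] (S : SimpleIntegrand P T W) (hW : IsWhiteNoise P T W)
    (q : (ℝ × ℝ) × Ω) : S.mean.eval q = ∫ ω, S.eval (q.1, ω) ∂P := by
  simp_rw [eval_eq]
  rw [integral_finsetSum _ fun k _ => ((S.memLp_coeff hW k 1).integrable le_rfl).const_mul _]
  exact Finset.sum_congr rfl fun k _ => (integral_const_mul _ _).symm

theorem hasGaussianLaw_integral_mean (S : SimpleIntegrand P T W) (hW : IsWhiteNoise P T W)
    (j : Fin d) : HasGaussianLaw (S.mean.integral j) P := by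
  have h := (hW.gaussian.comp_right fun k : Fin S.n => (j, S.rect k)).smul
    fun k => ∫ ω, S.X k ω ∂P
  exact (h.hasGaussianLaw_fun_sum (I := Finset.univ))

theorem integral_integral_mean (S : SimpleIntegrand P T W) (hW : IsWhiteNoise P T W)
    (j : Fin d) : ∫ ω, S.mean.integral j ω ∂P = 0 := by
  have : ∀ ω, S.mean.integral j ω = ∑ k, (∫ ω, S.X k ω ∂P) * W j (S.rect k) ω := fun _ => rfl
  simp_rw [this]
  rw [integral_finsetSum _ fun k _ => (hW.integrable j (S.rect k)).const_mul _]
  simp [integral_const_mul, hW.mean_zero]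

end SimpleIntegrand

/-! ### Walsh integrals of deterministic kernels and the law of the increments. -/

/-- Averaging the coefficients does not increase the distance to a deterministic function. -/
theorem SimpleIntegrand.eLpNorm_eval_mean_sub_le [IsProbabilityMeasure P]
    (S : SimpleIntegrand P T W) (hW : IsWhiteNoise P T W) {φ : ℝ × ℝ → ℝ} (hφ : Measurable φ) :
    eLpNorm (S.mean.eval - fun q => φ q.1) 2 ((volume.restrict (strip T)).prod P) ≤
      eLpNorm (S.eval - fun q => φ q.1) 2 ((volume.restrict (strip T)).prod P) := by
  have hφ' : AEStronglyMeasurable (fun q : (ℝ × ℝ) × Ω => φ q.1)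
      ((volume.restrict (strip T)).prod P) := (hφ.comp measurable_fst).aestronglyMeasurable
  have hm := ((S.memLp_eval hW).1.sub hφ').enorm.pow_const 2
  have hm' := ((S.mean.memLp_eval hW).1.sub hφ').enorm.pow_const 2
  rw [← ENNReal.pow_le_pow_left_iff two_ne_zero, eLpNorm_two_sq, eLpNorm_two_sq,
    lintegral_prod _ hm, lintegral_prod _ hm']
  refine lintegral_mono fun z => ?_
  have hi : Integrable (fun ω => S.eval (z, ω)) P := by
    simp_rw [S.eval_eq]
    exact integrable_finsetSum _ fun k _ =>
      ((S.memLp_coeff hW k 1).integrable le_rfl).const_mul _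
  -- As `φ z` does not depend on `ω`, the averaged error is the mean of the error, and Jensen's
  -- inequality applies for each `z`.
  have : ∀ ω, S.mean.eval (z, ω) - φ z = ∫ ω, (S.eval (z, ω) - φ z) ∂P := by
    intro ω
    rw [MeasureTheory.integral_sub hi (integrable_const _), S.eval_mean hW]
    simp
  simp only [Pi.sub_apply, this]
  rw [lintegral_const, measure_univ, mul_one]
  exact enorm_integral_sq_le (hi.sub (integrable_const _)).1

theorem IsWalshIntegral.sub [IsProbabilityMeasure P] (hW : IsWhiteNoise P T W) {j : Fin d}
    {Φ Ψ : (ℝ × ℝ) × Ω → ℝ} {I J : Ω → ℝ} (hI : IsWalshIntegral P T W j Φ I)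
    (hJ : IsWalshIntegral P T W j Ψ J) : IsWalshIntegral P T W j (Φ - Ψ) (I - J) := by
  obtain ⟨hΦ, hI2, S, hS, hSI⟩ := hI
  obtain ⟨hΨ, hJ2, R, hR, hRJ⟩ := hJ
  refine ⟨hΦ.sub hΨ, hI2.sub hJ2, fun n => (S n).sub (R n), ?_, ?_⟩
  · refine tendsto_of_tendsto_of_tendsto_of_le_of_le tendsto_const_nhds
      (by simpa using hS.add hR) (fun _ => zero_le) fun n => ?_
    rw [SimpleIntegrand.eval_sub, sub_sub_sub_comm]
    exact eLpNorm_sub_le (((S n).memLp_eval hW).1.sub hΦ.1) (((R n).memLp_eval hW).1.sub hΨ.1)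
      one_le_two
  · refine tendsto_of_tendsto_of_tendsto_of_le_of_le tendsto_const_nhds
      (by simpa using hSI.add hRJ) (fun _ => zero_le) fun n => ?_
    rw [SimpleIntegrand.integral_sub, sub_sub_sub_comm]
    exact eLpNorm_sub_le (((S n).memLp_integral hW j).1.sub hI2.1)
      (((R n).memLp_integral hW j).1.sub hJ2.1) one_le_two

/-- The isometry property of the Walsh integral. -/
theorem IsWalshIntegral.eLpNorm_eq [IsProbabilityMeasure P] (hW : IsWhiteNoise P T W) {j : Fin d}
    {Φ : (ℝ × ℝ) × Ω → ℝ} {I : Ω → ℝ} (hI : IsWalshIntegral P T W j Φ I) :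
    eLpNorm I 2 P = eLpNorm Φ 2 ((volume.restrict (strip T)).prod P) := by
  obtain ⟨hΦ, hI2, S, hS, hSI⟩ := hI
  have h1 := tendsto_eLpNorm_of_tendsto_sub (fun n => (S n).memLp_integral hW j) hI2 hSI
  have h2 := tendsto_eLpNorm_of_tendsto_sub (fun n => (S n).memLp_eval hW) hΦ hS
  simp_rw [(S _).eLpNorm_integral hW j] at h1
  exact tendsto_nhds_unique h1 h2

/-- The Walsh integral of a deterministic function is centered Gaussian, with variance the squared
`L²` norm of the function. -/
theorem IsWalshIntegral.map_eq_gaussianReal [IsProbabilityMeasure P] (hW : IsWhiteNoise P T W)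
    {j : Fin d} {φ : ℝ × ℝ → ℝ} (hφ : Measurable φ) {I : Ω → ℝ}
    (hI : IsWalshIntegral P T W j (fun q => φ q.1) I) :
    ∃ r : ℝ≥0, (r : ℝ≥0∞) ^ 2 = ∫⁻ z in strip T, ‖φ z‖ₑ ^ 2 ∧
      P.map I = gaussianReal 0 (r ^ 2) := by
  have hnorm : eLpNorm I 2 P = eLpNorm φ 2 (volume.restrict (strip T)) := by
    rw [hI.eLpNorm_eq hW]
    exact eLpNorm_comp_measurePreserving hφ.aestronglyMeasurable measurePreserving_fst
  obtain ⟨hΦ, hI2, S, hS, hSI⟩ := hI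
  refine ⟨(eLpNorm I 2 P).toNNReal, ?_, ?_⟩
  · rw [ENNReal.coe_toNNReal hI2.2.ne, hnorm, eLpNorm_two_sq]
  refine map_eq_gaussianReal_of_tendsto (fun n => (S n).hasGaussianLaw_integral_mean hW j)
    (fun n => (S n).integral_integral_mean hW j) hI2 ?_
  -- The isometry turns the distance between the two integrals into that between `S n` and its mean,
  -- at most twice the distance from `S n` to `φ`; hence the repeated term.
  have hlim : Tendsto (fun n => (eLpNorm ((S n).eval - fun q => φ q.1) 2
      ((volume.restrict (strip T)).prod P) + eLpNorm ((S n).eval - fun q => φ q.1) 2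
      ((volume.restrict (strip T)).prod P)) + eLpNorm ((S n).integral j - I) 2 P) atTop (𝓝 0) := by
    simpa using (hS.add hS).add hSI
  refine tendsto_of_tendsto_of_tendsto_of_le_of_le tendsto_const_nhds hlim
    (fun _ => zero_le) fun n => ?_
  have e1 : (S n).mean.integral j - I =
      ((S n).mean.integral j - (S n).integral j) + ((S n).integral j - I) := by abel
  have e2 : (S n).mean.eval - (S n).eval =
      ((S n).mean.eval - fun q => φ q.1) - ((S n).eval - fun q => φ q.1) := by abel
  have hm := (S n).mean.memLp_integral hW j
  have hs := (S n).memLp_integral hW j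
  calc eLpNorm ((S n).mean.integral j - I) 2 P
      ≤ eLpNorm ((S n).mean.integral j - (S n).integral j) 2 P +
          eLpNorm ((S n).integral j - I) 2 P := by
        rw [e1]
        exact eLpNorm_add_le (hm.sub hs).1 (hs.sub hI2).1 one_le_two
    _ ≤ _ := by
        gcongr
        rw [← SimpleIntegrand.integral_sub, SimpleIntegrand.eLpNorm_integral _ hW,
          SimpleIntegrand.eval_sub, e2]
        refine (eLpNorm_sub_le (((S n).mean.memLp_eval hW).1.sub hΦ.1)
          (((S n).memLp_eval hW).1.sub hΦ.1) one_le_two).trans ?_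
        gcongr
        exact (S n).eLpNorm_eval_mean_sub_le hW hφ

/-- The increments of the solution of the linear equation are centered Gaussian. -/
theorem IsMildSolution.map_sub_eq_gaussianReal [IsProbabilityMeasure P] {α : ℝ}
    {v : ℝ → ℝ → Ω → Fin d → ℝ} (hW : IsWhiteNoise P T W)
    (hv : IsMildSolution α P T W (fun _ => 1) (fun _ => 0) v) {s t : ℝ} (hs : s ∈ Icc 0 T)
    (ht : t ∈ Icc 0 T) (x y : ℝ) (i : Fin d) :
    AEMeasurable (fun ω => v t x ω i - v s y ω i) P ∧
    ∃ r : ℝ≥0, (r : ℝ≥0∞) ^ 2 =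
        ∫⁻ z in strip T, ‖heatIntegrand α t x z - heatIntegrand α s y z‖ₑ ^ 2 ∧
      P.map (fun ω => v t x ω i - v s y ω i) = gaussianReal 0 (r ^ 2) := by
  have key : ∀ t ∈ Icc 0 T, ∀ x, ∃ I : Ω → ℝ,
      IsWalshIntegral P T W i (fun q => heatIntegrand α t x q.1) I ∧
      (fun ω => v t x ω i) =ᵐ[P] I := by
    intro t ht x
    obtain ⟨I, hI, -, hae⟩ := hv.mild t ht x i
    -- For `σ = Id` the off-diagonal integrands vanish, and the isometry forces their integrals to
    -- be null.
    have hzero : ∀ j, j ≠ i → I j =ᵐ[P] 0 := by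
      intro j hj
      have h := (hI j).eLpNorm_eq hW
      have h0 : (fun q : (ℝ × ℝ) × Ω => if q.1.1 < t then greenKernel α (t - q.1.1) (x - q.1.2) *
          (1 : Matrix (Fin d) (Fin d) ℝ) i j else 0) = 0 := by
        ext q
        simp [Matrix.one_apply_ne hj.symm]
      rw [h0, eLpNorm_zero] at h
      exact (eLpNorm_eq_zero_iff (hI j).2.1.1 two_ne_zero).1 h
    refine ⟨I i, by simpa [heatIntegrand] using hI i, ?_⟩
    have hzero' : ∀ᵐ ω ∂P, ∀ j, j ≠ i → I j ω = 0 := by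
      rw [ae_all_iff]
      intro j
      by_cases hj : j = i
      · simp [hj]
      · filter_upwards [hzero j hj] with ω hω _ using hω
    filter_upwards [hae, hzero'] with ω h1 h2
    rw [h1, Finset.sum_eq_single i (fun j _ hj => h2 j hj) (fun h => absurd (Finset.mem_univ i) h)]
    simp
  obtain ⟨I, hI, hIv⟩ := key t ht x
  obtain ⟨J, hJ, hJv⟩ := key s hs y
  have hae : (fun ω => v t x ω i - v s y ω i) =ᵐ[P] I - J := hIv.sub hJv
  have hIJ := hI.sub hW hJ
  refine ⟨hIJ.2.1.1.aemeasurable.congr hae.symm, ?_⟩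
  rw [Measure.map_congr hae]
  exact IsWalshIntegral.map_eq_gaussianReal hW
    ((measurable_heatIntegrand α t x).sub (measurable_heatIntegrand α s y)) hIJ

end FracHeat

end

/-! ### From the variance bound to moments of order `p`. -/

theorem proposition5p2 (α : ℝ) (hα₁ : 1 < α) (hα₂ : α ≤ 2) (t₀ : ℝ) (ht₀ : 0 < t₀)
    (p : ℝ) (hp : 1 < p) (K : Set ℝ) (hK : IsCompact K) :
    ∃ c : ℝ, 0 < c ∧
      ∀ (T : ℝ), t₀ < T →
      ∀ (d : ℕ) (hd : 0 < d) (Ω : Type*) [MeasurableSpace Ω] (P : Measure Ω)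
        [IsProbabilityMeasure P] (W : Fin d → Set (ℝ × ℝ) → Ω → ℝ)
        (v : ℝ → ℝ → Ω → Fin d → ℝ),
        FracHeat.IsWhiteNoise P T W →
        FracHeat.IsMildSolution α P T W (fun _ => 1) (fun _ => 0) v →
        ∀ s t x y : ℝ, t₀ ≤ s → s ≤ t → t ≤ T → x ∈ K → y ∈ K →
          c * (|t - s| ^ ((α - 1) / α) + |x - y| ^ (α - 1)) ^ (p / 2) ≤
            ∫ ω, |v t x ω ⟨0, hd⟩ - v s y ω ⟨0, hd⟩| ^ p ∂P := by
  obtain ⟨D, hD⟩ := Metric.isBounded_iff.1 hK.isBounded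
  obtain ⟨c, hc, hbound⟩ := FracHeat.exists_le_lintegral_heatIntegrand hα₁ hα₂ ht₀ D
  have hm := FracHeat.integral_abs_rpow_gaussianReal_pos (p := p) (by linarith)
  -- The variance constant to the power `p/2`, times `E|N|^p` for a standard Gaussian `N`; it is
  -- fixed before `T`, `d` and the noise.
  refine ⟨c ^ (p / 2) * ∫ x, |x| ^ p ∂(gaussianReal 0 1), by positivity, ?_⟩
  intro T _ d hd Ω _ P _ W v hW hv s t x y hs hst htT hx hy
  have hs0 : 0 ≤ s := ht₀.le.trans hs
  obtain ⟨hmeas, r, hr, hlaw⟩ := hv.map_sub_eq_gaussianReal hW ⟨hs0, hst.trans htT⟩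
    ⟨hs0.trans hst, htT⟩ x y ⟨0, hd⟩
  rw [FracHeat.integral_abs_rpow_of_map_eq_gaussianReal hmeas hlaw, mul_right_comm,
    ← Real.mul_rpow hc.le (by positivity)]
  have hV := hbound T s t x y hs hst htT (hD hx hy)
  rw [← hr, ← ENNReal.coe_pow, ENNReal.ofReal_le_coe, NNReal.coe_pow] at hV
  have hrp : (r : ℝ) ^ p = ((r : ℝ) ^ 2) ^ (p / 2) := by
    rw [← Real.rpow_natCast_mul r.coe_nonneg]
    congr 1
    push_cast
    ring
  rw [hrp]
  gcongr
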